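/- A path of a tree is identified with its (non-empty) set of vertices, and is trivial if it consists of a single vertex. A CPT representation of a finite poset $\mathbf P=(X,P)$ assigns to the elements $x\in X$ pairwise distinct paths $W_x$ of a finite tree (the host tree) such that $x<y$ in $\mathbf P$ if and only if $W_x\subsetneq W_y$. Two representations $\{W_x\}$ and $\{W'_x\}$ are equivalent if for all $x,y\in X$ one has $W_x\subsetneq W_y$ if and only if $W'_x\subsetneq W'_y$. The poset $\mathbf P$ is dually-CPT if both $\mathbf P$ and its dual $\mathbf P^d$ have a CPT representation. A set $M\subseteq X$ is a module if every $y\in X\setminus M$ is either comparable to all elements of $M$ or incomparable to all elements of $M$; a module $M$ is strong if every module $M'$ satisfies $M\cap M'=\varnothing$, $M\subseteq M'$ or $M'\subseteq M$; it is non-trivial if $M\neq X$ and $M$ has at least two elements. **Theorem.** Let $\mathbf P$ be a finite dually-CPT poset whose comparability graph is connected. For every CPT representation $\{W_x\}_{x\in X}$ of $\mathbf P$ there is an equivalent CPT representation $\{W'_x\}_{x\in X}$ of $\mathbf P$ such that, for every non-trivial strong module $M$ of $\mathbf P$ and every $x\in M$, the path $W'_x$ is non-trivial. -/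

import Mathlib

/-- Two elements of a poset are comparable when one is strictly below the other. -/
def Comparable {X : Type*} [PartialOrder X] (x y : X) : Prop := x < y ∨ y < x

/-- The comparability graph of a poset. -/
def comparabilityGraph (X : Type*) [PartialOrder X] : SimpleGraph X where
  Adj x y := Comparable x y
  symm := ⟨fun _ _ h => Or.symm h⟩
  loopless := ⟨fun x h => h.elim (lt_irrefl x) (lt_irrefl x)⟩

/-- A module of a poset: every outside element is comparable to all or to none of its elements. -/
def IsModule {X : Type*} [PartialOrder X] (M : Set X) : Prop :=
  ∀ y ∉ M, (∀ x ∈ M, Comparable y x) ∨ (∀ x ∈ M, ¬ Comparable y x)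

/-- A strong module: a module that overlaps no other module. -/
def IsStrongModule {X : Type*} [PartialOrder X] (M : Set X) : Prop :=
  IsModule M ∧ ∀ M' : Set X, IsModule M' → M ∩ M' = ∅ ∨ M ⊆ M' ∨ M' ⊆ M

/-- A strong module other than the whole set and the singletons (and the empty set). -/
def IsNontrivialStrongModule {X : Type*} [PartialOrder X] (M : Set X) : Prop :=
  IsStrongModule M ∧ M.Nontrivial ∧ M ≠ Set.univ

/-- `S` is the vertex set of a path of the graph `T`. -/
def IsPathSet {V : Type*} (T : SimpleGraph V) (S : Set V) : Prop :=
  ∃ (u v : V) (p : T.Walk u v), p.IsPath ∧ S = {w | w ∈ p.support}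

/-- A trivial path consists of a single vertex. -/
def IsTrivialPath {V : Type*} (S : Set V) : Prop := ∃ a, S = {a}

/-- A CPT representation of the poset `X`: pairwise distinct paths of a finite host tree, one for
each element, such that the strict order of `X` is proper containment of paths. -/
structure CPTRepresentation (X : Type*) [PartialOrder X] where
  /-- The vertices of the host tree. -/
  Vertex : Type
  finite_vertex : Finite Vertex
  /-- The host tree. -/
  tree : SimpleGraph Vertex
  isTree : tree.IsTree
  /-- The path representing an element, as a set of vertices. -/
  path : X → Set Vertex
  isPathSet : ∀ x, IsPathSet tree (path x)
  path_injective : Function.Injective path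
  lt_iff : ∀ x y, x < y ↔ path x ⊂ path y

/-- Two representations are equivalent when their paths have the same containment relations. -/
def CPTRepresentation.Equivalent {X : Type*} [PartialOrder X] (R R' : CPTRepresentation X) :
    Prop :=
  ∀ x y, R.path x ⊂ R.path y ↔ R'.path x ⊂ R'.path y

/-- A CPT poset: a poset that has a CPT representation. -/
def IsCPT (X : Type*) [PartialOrder X] : Prop := Nonempty (CPTRepresentation X)

/-- A dually-CPT poset: both it and its dual are CPT. -/
def IsDuallyCPT (X : Type*) [PartialOrder X] : Prop := IsCPT X ∧ IsCPT Xᵒᵈ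

/-! Suppose `x` in a non-trivial strong module `M` has the trivial path `{a}`. Then `x` is minimal.
An outside element comparable to a strong module lies entirely above or entirely below it, so here
entirely above; connectivity provides one such element. If `x'` is another element of `M` and `c ≠
a` lies on its path, every path above `M` contains `a` and `c`, hence the neighbour `b` of `a`
towards `c`. Subdivide `ab` and add the new vertex to all paths through `a`. Inclusions are
unchanged, so only being a path is at stake. Outside `M`, a path through `a` lies above `M` and
contains `b`. Inside `M`, a path through `a` that misses `b` ends at `a`: otherwise a larger path
above `M` would contain three neighbours of `a`. In both cases the new vertex fits. The path of `x`
is now non-trivial and no trivial path is created, so a representation with a minimal set of trivial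
paths has none in such modules. -/

/-! ### Subdividing an edge of a tree. -/

namespace SimpleGraph

variable {V : Type*}

/-- The graph obtained by subdividing the edge `ab`, the new vertex being `none`. -/
def subdivide (T : SimpleGraph V) (a b : V) : SimpleGraph (Option V) where
  Adj
    | some u, some v => T.Adj u v ∧ s(u, v) ≠ s(a, b)
    | none, some v => v = a ∨ v = b
    | some u, none => u = a ∨ u = b
    | none, none => False
  symm := ⟨by
    rintro (_ | u) (_ | v) h
    · exact h
    · exact h
    · exact h
    · exact ⟨h.1.symm, by rw [Sym2.eq_swap]; exact h.2⟩⟩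
  loopless := ⟨by
    rintro (_ | u) h
    · exact h
    · exact T.loopless.irrefl u h.1⟩

theorem Connected.subdivide {T : SimpleGraph V} (hT : T.Connected) (a b : V) :
    (T.subdivide a b).Connected := by
  have ha : (T.subdivide a b).Adj none (some a) := Or.inl rfl
  have hb : (T.subdivide a b).Adj none (some b) := Or.inr rfl
  have hadj : ∀ u v, T.Adj u v → (T.subdivide a b).Reachable (some u) (some v) := by
    intro u v h
    by_cases he : s(u, v) = s(a, b)
    · rcases Sym2.eq_iff.1 he with ⟨rfl, rfl⟩ | ⟨rfl, rfl⟩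
      · exact ha.symm.reachable.trans hb.reachable
      · exact hb.symm.reachable.trans ha.reachable
    · exact Adj.reachable (G := T.subdivide a b) (u := some u) (v := some v) ⟨h, he⟩
  have hsome : ∀ u v, (T.subdivide a b).Reachable (some u) (some v) := by
    intro u v
    obtain ⟨p⟩ := hT.preconnected u v
    induction p with
    | nil => exact Reachable.refl _
    | cons h _ ih => exact (hadj _ _ h).trans ih
  have hnone : ∀ v, (T.subdivide a b).Reachable none (some v) := fun v =>
    ha.reachable.trans (hsome a v)
  refine { preconnected := ?_, nonempty := ⟨none⟩ }
  rintro (_ | u) (_ | v)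
  · exact Reachable.refl _
  · exact hnone v
  · exact (hnone u).symm
  · exact hsome u v

theorem edgeSet_subdivide (T : SimpleGraph V) (a b : V) :
    (T.subdivide a b).edgeSet =
      Sym2.map some '' (T.edgeSet \ {s(a, b)}) ∪ {s(none, some a), s(none, some b)} := by
  ext e
  constructor
  · induction e with
    | _ x y =>
      rcases x with _ | u <;> rcases y with _ | v
      · exact fun h => h.elim
      · rintro (rfl | rfl)
        · exact Or.inr (Or.inl rfl)
        · exact Or.inr (Or.inr rfl)
      · rintro (rfl | rfl)
        · exact Or.inr (Or.inl Sym2.eq_swap)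
        · exact Or.inr (Or.inr Sym2.eq_swap)
      · exact fun h => Or.inl ⟨s(u, v), ⟨h.1, h.2⟩, rfl⟩
  · rintro (⟨e, he, rfl⟩ | rfl | rfl)
    · induction e with
      | _ u v => exact ⟨he.1, he.2⟩
    · exact Or.inl rfl
    · exact Or.inr rfl

/-- Connectivity persists, and one vertex and one edge (two new, one lost) are gained. -/
theorem IsTree.subdivide [Finite V] {T : SimpleGraph V} (hT : T.IsTree) {a b : V}
    (hab : T.Adj a b) : (T.subdivide a b).IsTree := by
  have hcard := (isTree_iff_connected_and_card.1 hT).2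
  refine isTree_iff_connected_and_card.2 ⟨hT.connected.subdivide a b, ?_⟩
  have hmem : s(a, b) ∈ T.edgeSet := hab
  have hdisj : Disjoint (Sym2.map some '' (T.edgeSet \ {s(a, b)}))
      {s(none, some a), s(none, some b)} := by
    rw [Set.disjoint_left]
    rintro _ ⟨e, _, rfl⟩ h
    induction e with
    | _ u v => simp at h
  have hpair : ({s(none, some a), s(none, some b)} : Set (Sym2 (Option V))).ncard = 2 :=
    Set.ncard_pair (by simpa using hab.ne)
  have hpos : T.edgeSet.ncard ≠ 0 := Set.ncard_ne_zero_of_mem hmem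
  rw [Nat.card_coe_set_eq] at hcard ⊢
  rw [edgeSet_subdivide, Set.ncard_union_eq hdisj, hpair,
    Set.ncard_image_of_injective _ (Sym2.map.injective (Option.some_injective V)),
    Set.ncard_sdiff_singleton_of_mem hmem, Finite.card_option]
  omega

theorem isChain_map_some {T : SimpleGraph V} {a b : V} {l : List V} (hl : l.IsChain T.Adj)
    (h : a ∉ l ∨ b ∉ l) : (l.map some).IsChain (T.subdivide a b).Adj := by
  rw [List.isChain_map]
  refine hl.imp_of_mem_imp fun u v hu hv huv => ⟨huv, fun he => ?_⟩
  rcases Sym2.eq_iff.1 he with ⟨rfl, rfl⟩ | ⟨rfl, rfl⟩ <;> tauto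

/-- An edge from `a` to a later vertex of the path would close a cycle. -/
theorem IsAcyclic.eq_head_of_adj {T : SimpleGraph V} (hT : T.IsAcyclic) {a e d : V} {l : List V}
    (hl : (a :: e :: l).IsChain T.Adj) (hn : (a :: e :: l).Nodup) (had : T.Adj a d)
    (hd : d ∈ e :: l) : d = e := by
  have hp : (Walk.ofSupport _ (List.cons_ne_nil a (e :: l)) hl).IsPath := by
    rw [Walk.isPath_def, Walk.support_ofSupport]
    exact hn
  have := hT.eq_snd_of_adj_start hp had
    (by rw [Walk.support_ofSupport]; exact List.mem_cons_of_mem _ hd)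
  exact this.trans (Walk.snd_cons (Walk.ofSupport (e :: l) (List.cons_ne_nil e l) hl.of_cons)
    hl.rel)

end SimpleGraph

/-! ### Paths under subdivision. -/

section PathSet

variable {V : Type*} {T : SimpleGraph V} {S : Set V} {a b : V}

theorem isPathSet_iff_exists_list :
    IsPathSet T S ↔ ∃ l : List V, l ≠ [] ∧ l.Nodup ∧ l.IsChain T.Adj ∧ S = {w | w ∈ l} := by
  constructor
  · rintro ⟨u, v, p, hp, rfl⟩
    exact ⟨p.support, p.support_ne_nil, hp.support_nodup, p.isChain_adj_support, rfl⟩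
  · rintro ⟨l, hne, hn, hl, rfl⟩
    refine ⟨_, _, SimpleGraph.Walk.ofSupport l hne hl, ?_, ?_⟩
    · rw [SimpleGraph.Walk.isPath_def, SimpleGraph.Walk.support_ofSupport]
      exact hn
    · rw [SimpleGraph.Walk.support_ofSupport]

/-- `S` consists of two paths `l₁` and `l₂` leaving `a` that meet only in `a`. -/
structure IsArms (T : SimpleGraph V) (a : V) (l₁ l₂ : List V) (S : Set V) : Prop where
  left : (a :: l₁).IsChain T.Adj
  right : (a :: l₂).IsChain T.Adj
  nodup : (a :: (l₁ ++ l₂)).Nodup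
  eq : S = {w | w ∈ a :: (l₁ ++ l₂)}

theorem IsArms.swap {l₁ l₂ : List V} (h : IsArms T a l₁ l₂ S) : IsArms T a l₂ l₁ S where
  left := h.right
  right := h.left
  nodup := (List.Perm.cons a List.perm_append_comm).nodup_iff.1 h.nodup
  eq := h.eq.trans (Set.ext fun _ => (List.Perm.cons a List.perm_append_comm).mem_iff)

theorem IsArms.isPathSet {l₁ l₂ : List V} (h : IsArms T a l₁ l₂ S) : IsPathSet T S := by
  have hp : (l₁.reverse ++ a :: l₂).Perm (a :: (l₁ ++ l₂)) :=
    List.perm_middle.trans (List.Perm.cons a ((List.reverse_perm l₁).append_right l₂))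
  refine isPathSet_iff_exists_list.2 ⟨l₁.reverse ++ a :: l₂, by simp, hp.nodup_iff.2 h.nodup, ?_,
    h.eq.trans (Set.ext fun _ => hp.mem_iff.symm)⟩
  rw [List.isChain_split]
  refine ⟨?_, h.right⟩
  rw [← List.reverse_cons, List.isChain_reverse]
  exact h.left.imp fun _ _ => SimpleGraph.Adj.symm

theorem IsPathSet.exists_isArms (h : IsPathSet T S) (ha : a ∈ S) :
    ∃ l₁ l₂, IsArms T a l₁ l₂ S := by
  obtain ⟨l, -, hn, hl, rfl⟩ := isPathSet_iff_exists_list.1 h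
  obtain ⟨s, t, rfl⟩ := List.append_of_mem ha
  have hp : (s ++ a :: t).Perm (a :: (s.reverse ++ t)) :=
    List.perm_middle.trans (List.Perm.cons a ((List.reverse_perm s).symm.append_right t))
  rw [List.isChain_split] at hl
  refine ⟨s.reverse, t, ?_, hl.2, hp.nodup_iff.1 hn, Set.ext fun _ => hp.mem_iff⟩
  have := hl.1
  rw [← List.reverse_reverse (s ++ [a]), List.isChain_reverse] at this
  simpa using this.imp fun _ _ => SimpleGraph.Adj.symm

/-- The vertex set obtained from `S` by adding the subdividing vertex next to `a`. -/
def subdividePath (a : V) (S : Set V) : Set (Option V) :=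
  {w | (∃ v ∈ S, w = some v) ∨ (w = none ∧ a ∈ S)}

theorem some_mem_subdividePath {v : V} : some v ∈ subdividePath a S ↔ v ∈ S := by
  simp [subdividePath]

theorem none_mem_subdividePath : none ∈ subdividePath a S ↔ a ∈ S := by
  simp [subdividePath]

theorem subdividePath_subset_iff {S' : Set V} :
    subdividePath a S ⊆ subdividePath a S' ↔ S ⊆ S' := by
  constructor
  · intro h v hv
    exact some_mem_subdividePath.1 (h (some_mem_subdividePath.2 hv))
  · rintro h (_ | v) hw
    · exact none_mem_subdividePath.2 (h (none_mem_subdividePath.1 hw))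
    · exact some_mem_subdividePath.2 (h (some_mem_subdividePath.1 hw))

/-- The new vertex is inserted right after `a` on the second arm; the first arm avoids `b`, so it
does not use the removed edge. -/
theorem IsArms.subdividePath_of_isChain {l₁ l₂ : List V} (h : IsArms T a l₁ l₂ S)
    (hb : b ∉ l₁) (hab : a ≠ b)
    (h₂ : (none :: l₂.map some).IsChain (T.subdivide a b).Adj) :
    IsArms (T.subdivide a b) (some a) (l₁.map some) (none :: l₂.map some)
      (subdividePath a S) where
  left := SimpleGraph.isChain_map_some (l := a :: l₁) h.left (Or.inr (by simp [hab.symm, hb]))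
  right := List.isChain_cons_cons.2 ⟨Or.inl rfl, h₂⟩
  nodup := by
    have hp : (some a :: (l₁.map some ++ none :: l₂.map some)).Perm
        (none :: (a :: (l₁ ++ l₂)).map some) := by
      simp only [List.map_cons, List.map_append]
      exact (List.Perm.cons _ List.perm_middle).trans (List.Perm.swap _ _ _)
    rw [hp.nodup_iff, List.nodup_cons]
    exact ⟨by simp, h.nodup.map (Option.some_injective V)⟩
  eq := by
    ext (_ | w)
    · rw [none_mem_subdividePath, h.eq]
      simp
    · rw [some_mem_subdividePath, h.eq]
      simp

theorem IsArms.isPathSet_subdividePath_of_mem {l₁ l₂ : List V} (hT : T.IsAcyclic)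
    (hab : T.Adj a b) (h : IsArms T a l₁ l₂ S) (hb : b ∈ l₂) :
    IsPathSet (T.subdivide a b) (subdividePath a S) := by
  obtain _ | ⟨e, t⟩ := l₂
  · simp at hb
  have hn : (a :: e :: t).Nodup := h.nodup.sublist (by simp)
  obtain rfl := hT.eq_head_of_adj h.right hn hab hb
  refine (h.subdividePath_of_isChain ?_ hab.ne ?_).isPathSet
  · have := h.nodup
    grind
  · rw [List.map_cons, List.isChain_cons_cons]
    exact ⟨Or.inr rfl, SimpleGraph.isChain_map_some (l := b :: t) h.right.of_cons
      (Or.inl (List.nodup_cons.1 hn).1)⟩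

theorem IsPathSet.subdividePath_of_mem (hT : T.IsAcyclic) (hab : T.Adj a b) (h : IsPathSet T S)
    (ha : a ∈ S) (hb : b ∈ S) : IsPathSet (T.subdivide a b) (subdividePath a S) := by
  obtain ⟨l₁, l₂, hl⟩ := h.exists_isArms ha
  have hb' := hb
  rw [hl.eq, Set.mem_ofPred_eq, List.mem_cons, List.mem_append] at hb'
  rcases hb' with hb' | hb' | hb'
  · exact (hab.ne hb'.symm).elim
  · exact hl.swap.isPathSet_subdividePath_of_mem hT hab hb'
  · exact hl.isPathSet_subdividePath_of_mem hT hab hb'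

theorem IsPathSet.subdividePath_of_notMem (h : IsPathSet T S) (ha : a ∉ S) :
    IsPathSet (T.subdivide a b) (subdividePath a S) := by
  obtain ⟨l, hne, hn, hl, rfl⟩ := isPathSet_iff_exists_list.1 h
  refine isPathSet_iff_exists_list.2 ⟨l.map some, by simpa using hne,
    hn.map (Option.some_injective V), SimpleGraph.isChain_map_some hl (Or.inl ha), ?_⟩
  ext (_ | w)
  · rw [none_mem_subdividePath]
    simpa using ha
  · rw [some_mem_subdividePath]
    simp

/-- A path through `a` contains at most two neighbours of `a`. -/
theorem IsPathSet.eq_or_eq_of_adj (hT : T.IsAcyclic) (h : IsPathSet T S) (ha : a ∈ S)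
    {c d : V} (hb : b ∈ S) (hc : c ∈ S) (hd : d ∈ S) (hab : T.Adj a b) (hac : T.Adj a c)
    (had : T.Adj a d) : b = c ∨ b = d ∨ c = d := by
  obtain ⟨l₁, l₂, hl⟩ := h.exists_isArms ha
  have key : ∀ {l : List V}, (a :: l).IsChain T.Adj → (a :: l).Nodup → ∀ u v, u ∈ l → v ∈ l →
      T.Adj a u → T.Adj a v → u = v := by
    rintro (_ | ⟨e, t⟩) h₁ h₂ u v hu hv hau hav
    · simp at hu
    · rw [hT.eq_head_of_adj h₁ h₂ hau hu, hT.eq_head_of_adj h₁ h₂ hav hv]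
  have k₁ := key hl.left (hl.nodup.sublist (by simp))
  have k₂ := key hl.right (hl.nodup.sublist (by simp))
  rw [hl.eq, Set.mem_ofPred_eq, List.mem_cons, List.mem_append] at hb hc hd
  have := hab.ne
  have := hac.ne
  have := had.ne
  grind

/-- If `S` misses `b` and `a` is interior to `S`, its two neighbours in `S` and `b` are three
neighbours of `a` on the path `S'`. So `a` is an end of `S`, and the new vertex extends `S` there.
-/
theorem IsPathSet.subdividePath_of_subset (hT : T.IsAcyclic) (hab : T.Adj a b)
    (h : IsPathSet T S) (ha : a ∈ S) {S' : Set V} (h' : IsPathSet T S') (hS : S ⊆ S')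
    (hb : b ∈ S') : IsPathSet (T.subdivide a b) (subdividePath a S) := by
  by_cases hbS : b ∈ S
  · exact h.subdividePath_of_mem hT hab ha hbS
  obtain ⟨l₁, l₂, hl⟩ := h.exists_isArms ha
  have hmem : ∀ w, w ∈ S ↔ w ∈ a :: (l₁ ++ l₂) := fun w => by rw [hl.eq]; rfl
  have hnil : ∀ {l : List V}, IsArms T a l [] S →
      IsPathSet (T.subdivide a b) (subdividePath a S) := by
    intro l hl
    refine (hl.subdividePath_of_isChain ?_ hab.ne (by simp)).isPathSet
    intro hbl
    exact hbS (by rw [hl.eq]; simp [hbl])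
  obtain _ | ⟨c, t₁⟩ := l₁
  · exact hnil hl.swap
  obtain _ | ⟨d, t₂⟩ := l₂
  · exact hnil hl
  have hc : c ∈ S := (hmem c).2 (by simp)
  have hd : d ∈ S := (hmem d).2 (by simp)
  have hcd : c ≠ d := by
    have := hl.nodup
    grind
  rcases h'.eq_or_eq_of_adj hT (hS ha) hb (hS hc) (hS hd) hab
    (List.isChain_cons_cons.1 hl.left).1 (List.isChain_cons_cons.1 hl.right).1 with h | h | h
  · exact (hbS (h ▸ hc)).elim
  · exact (hbS (h ▸ hd)).elim
  · exact (hcd h).elim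

theorem IsPathSet.support_subset (hT : T.IsAcyclic) (h : IsPathSet T S) {c : V} (ha : a ∈ S)
    (hc : c ∈ S) {q : T.Walk a c} (hq : q.IsPath) : {w | w ∈ q.support} ⊆ S := by
  classical
  obtain ⟨u, v, p, hp, rfl⟩ := h
  have hsub : ∃ r : T.Walk a c, r.IsPath ∧ ∀ w ∈ r.support, w ∈ p.support := by
    have hc' := hc
    rw [Set.mem_ofPred_eq, ← p.take_spec ha, SimpleGraph.Walk.mem_support_append_iff] at hc'
    rcases hc' with hc' | hc'
    · refine ⟨((p.takeUntil a ha).dropUntil c hc').reverse,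
        ((hp.takeUntil ha).dropUntil hc').reverse, fun w hw => ?_⟩
      rw [SimpleGraph.Walk.support_reverse, List.mem_reverse] at hw
      exact p.support_takeUntil_subset_support ha
        (SimpleGraph.Walk.support_dropUntil_subset_support _ hc' hw)
    · exact ⟨(p.dropUntil a ha).takeUntil c hc', (hp.dropUntil ha).takeUntil hc', fun w hw =>
        p.support_dropUntil_subset_support ha
          (SimpleGraph.Walk.support_takeUntil_subset_support _ hc' hw)⟩
  obtain ⟨r, hr, hrp⟩ := hsub
  have : q = r := congrArg Subtype.val
    ((hT.subsingleton_path a c).elim ⟨q, hq⟩ ⟨r, hr⟩)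
  rw [this]
  exact hrp

/-- Some neighbour of `a` lies on every path through `a` and `c`. -/
theorem exists_adj_forall_isPathSet_mem (hT : T.IsTree) {c : V} (hac : a ≠ c) :
    ∃ b, T.Adj a b ∧ ∀ S, IsPathSet T S → a ∈ S → c ∈ S → b ∈ S := by
  obtain ⟨q, hq⟩ := (hT.connected.preconnected a c).exists_isPath
  cases q with
  | nil => exact (hac rfl).elim
  | cons h q =>
    refine ⟨_, h, fun S hS ha hc => hS.support_subset hT.isAcyclic ha hc hq ?_⟩
    simp

end PathSet

/-! ### Strong modules and the order. -/

section Modules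

variable {X : Type*} [PartialOrder X] {M : Set X}

/-- An element comparable to a strong module lies below all of it or above all of it. -/
theorem IsStrongModule.forall_lt_or_forall_lt (hM : IsStrongModule M) {y : X} (hy : y ∉ M)
    (hc : ∀ x ∈ M, Comparable y x) : (∀ x ∈ M, y < x) ∨ ∀ x ∈ M, x < y := by
  by_contra! hcon
  obtain ⟨⟨a, haM, ha⟩, ⟨b, hbM, hb⟩⟩ := hcon
  have hay : a < y := (hc a haM).resolve_left ha
  have hyb : y < b := (hc b hbM).resolve_right hb
  -- `Z` collects the outside elements that split `M` as `y` does. The module `Z ∪ A` overlaps `M`: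
  -- it contains `y` and `a` but not `b`.
  set Z : Set X := {z | z ∉ M ∧ ∀ x ∈ M, (x < y → x < z) ∧ (y < x → z < x)}
  set A : Set X := {x | x ∈ M ∧ x < y}
  have hmod : IsModule (Z ∪ A) := by
    intro w hw
    rw [Set.mem_union, not_or] at hw
    obtain ⟨hwZ, hwA⟩ := hw
    by_cases hwM : w ∈ M
    · left
      have hyw : y < w := (hc w hwM).resolve_right fun h => hwA ⟨hwM, h⟩
      rintro x (hx | hx)
      · exact Or.inr ((hx.2 w hwM).2 hyw)
      · exact Or.inr (hx.2.trans hyw)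
    rcases hM.1 w hwM with h | h
    · left
      rintro x (hx | hx)
      · have : ∃ m ∈ M, ¬ ((m < y → m < w) ∧ (y < m → w < m)) := by
          by_contra! hno
          exact hwZ ⟨hwM, hno⟩
        obtain ⟨m, hm, hmw⟩ := this
        rw [not_and_or, Classical.not_imp, Classical.not_imp] at hmw
        rcases hmw with ⟨hmy, hmw⟩ | ⟨hmy, hmw⟩
        · exact Or.inl (((h m hm).resolve_right hmw).trans ((hx.2 m hm).1 hmy))
        · exact Or.inr (((hx.2 m hm).2 hmy).trans ((h m hm).resolve_left hmw))
      · exact h x hx.1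
    -- Each element of `Z` lies between `a` and `b`, so comparability with it would make `w`
    -- comparable to `a` or `b`.
    · right
      rintro x (hx | hx)
      · rintro (hwx | hxw)
        · exact h b hbM (Or.inl (hwx.trans ((hx.2 b hbM).2 hyb)))
        · exact h a haM (Or.inr (((hx.2 a haM).1 hay).trans hxw))
      · exact h x hx.1
  rcases hM.2 _ hmod with h | h | h
  · exact Set.eq_empty_iff_forall_notMem.1 h a ⟨haM, Or.inr ⟨haM, hay⟩⟩
  · rcases h hbM with h | h
    · exact h.1 hbM
    · exact hb h.2
  · exact hy (h (Or.inl ⟨hy, fun _ _ => ⟨id, id⟩⟩))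

end Modules

theorem IsPathSet.nonempty {V : Type*} {T : SimpleGraph V} {S : Set V} (h : IsPathSet T S) :
    S.Nonempty := by
  obtain ⟨u, v, p, -, rfl⟩ := h
  exact ⟨u, p.start_mem_support⟩

theorem IsTrivialPath.of_subdividePath {V : Type*} {a : V} {S : Set V} (hS : S.Nonempty)
    (h : IsTrivialPath (subdividePath a S)) : IsTrivialPath S := by
  obtain ⟨w, hw⟩ := h
  obtain ⟨v, hv⟩ := hS
  have hsome : ∀ u ∈ S, some u = w := fun u hu => by
    have : some u ∈ subdividePath a S := some_mem_subdividePath.2 hu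
    rwa [hw] at this
  refine ⟨v, Set.eq_singleton_iff_unique_mem.2 ⟨hv, fun u hu => ?_⟩⟩
  exact Option.some_injective V ((hsome u hu).trans (hsome v hv).symm)

theorem not_isTrivialPath_subdividePath {V : Type*} {a : V} {S : Set V} (ha : a ∈ S) :
    ¬ IsTrivialPath (subdividePath a S) := by
  rintro ⟨w, hw⟩
  have h₁ : some a ∈ subdividePath a S := some_mem_subdividePath.2 ha
  have h₂ : none ∈ subdividePath a S := none_mem_subdividePath.2 ha
  rw [hw, Set.mem_singleton_iff] at h₁ h₂
  simp [← h₂] at h₁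

/-! ### Removing trivial paths from a representation. -/

namespace CPTRepresentation

variable {X : Type*} [PartialOrder X]

theorem equivalent (R R' : CPTRepresentation X) : R.Equivalent R' := fun x y =>
  (R.lt_iff x y).symm.trans (R'.lt_iff x y)

/-- The representation obtained by subdividing an edge `ab` of the host tree and adding the new
vertex to the paths through `a`. -/
def subdivide (R : CPTRepresentation X) {a b : R.Vertex} (hab : R.tree.Adj a b)
    (h : ∀ x, IsPathSet (R.tree.subdivide a b) (subdividePath a (R.path x))) :
    CPTRepresentation X where
  Vertex := Option R.Vertex
  finite_vertex := by
    have := R.finite_vertex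
    infer_instance
  tree := R.tree.subdivide a b
  isTree := by
    have := R.finite_vertex
    exact R.isTree.subdivide hab
  path x := subdividePath a (R.path x)
  isPathSet := h
  path_injective x y hxy := R.path_injective
    ((subdividePath_subset_iff.1 hxy.subset).antisymm (subdividePath_subset_iff.1 hxy.superset))
  lt_iff x y := by
    rw [R.lt_iff, ssubset_iff_subset_not_subset, ssubset_iff_subset_not_subset,
      subdividePath_subset_iff, subdividePath_subset_iff]

/-- A trivial path representing an element of a non-trivial strong module can be made non-trivial
without creating new trivial paths. -/
theorem exists_not_isTrivialPath (hconn : (comparabilityGraph X).Connected)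
    (R : CPTRepresentation X) {M : Set X} (hM : IsNontrivialStrongModule M) {x : X} (hx : x ∈ M)
    (htriv : IsTrivialPath (R.path x)) :
    ∃ R' : CPTRepresentation X, ¬ IsTrivialPath (R'.path x) ∧
      ∀ z, IsTrivialPath (R'.path z) → IsTrivialPath (R.path z) := by
  obtain ⟨hstrong, hnt, huniv⟩ := hM
  obtain ⟨a, ha⟩ := htriv
  have hax : a ∈ R.path x := by rw [ha]; rfl
  have hmin : ∀ y, ¬ y < x := fun y hy => by
    rw [R.lt_iff, ha, Set.ssubset_singleton_iff] at hy
    exact (R.isPathSet y).nonempty.ne_empty hy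
  obtain ⟨x', hx', hne⟩ := hnt.exists_ne x
  obtain ⟨c, hc, hca⟩ : ∃ c ∈ R.path x', a ≠ c := by
    by_contra! hcon
    refine hne (R.path_injective ?_)
    rw [ha]
    exact Set.eq_singleton_iff_nonempty_unique_mem.2
      ⟨(R.isPathSet x').nonempty, fun c hc => (hcon c hc).symm⟩
  have habove : ∀ y ∉ M, Comparable y x → ∀ m ∈ M, m < y := fun y hy hyx => by
    have hall := (hstrong.1 y hy).resolve_right fun h => h x hx hyx
    exact (hstrong.forall_lt_or_forall_lt hy hall).resolve_left fun h => hmin y (h x hx)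
  have hle : ∀ {y z : X}, y < z → R.path y ⊆ R.path z := fun h => ((R.lt_iff _ _).1 h).subset
  obtain ⟨z, hz⟩ := (Set.ne_univ_iff_exists_notMem M).1 huniv
  obtain ⟨p⟩ := hconn.preconnected x z
  -- A walk leaving `M` yields an outside element comparable to a member of `M`, hence above all of
  -- `M`.
  obtain ⟨d, -, hd₁, hd₂⟩ := p.exists_boundary_dart M hx hz
  have htop : ∀ m ∈ M, m < d.snd := by
    refine habove _ hd₂ (((hstrong.1 _ hd₂).resolve_right fun h => ?_) x hx)
    exact h _ hd₁ d.adj.symm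
  obtain ⟨b, hab, hb⟩ := exists_adj_forall_isPathSet_mem R.isTree hca
  have hbmem : ∀ y, (∀ m ∈ M, m < y) → b ∈ R.path y := fun y hy =>
    hb _ (R.isPathSet y) (hle (hy x hx) hax) (hle (hy x' hx') hc)
  have hpath : ∀ y, IsPathSet (R.tree.subdivide a b) (subdividePath a (R.path y)) := by
    intro y
    by_cases hay : a ∈ R.path y
    · by_cases hyM : y ∈ M
      · exact (R.isPathSet y).subdividePath_of_subset R.isTree.isAcyclic hab hay
          (R.isPathSet d.snd) (hle (htop y hyM)) (hbmem _ htop)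
      · have hxy : x < y := by
          rw [R.lt_iff]
          refine LE.le.ssubset_of_ne ?_ fun h => hyM (R.path_injective h ▸ hx)
          rwa [ha, Set.singleton_subset_iff]
        exact (R.isPathSet y).subdividePath_of_mem R.isTree.isAcyclic hab hay
          (hbmem y (habove y hyM (Or.inr hxy)))
    · exact (R.isPathSet y).subdividePath_of_notMem hay
  exact ⟨R.subdivide hab hpath, not_isTrivialPath_subdividePath hax,
    fun z hz => hz.of_subdividePath (R.isPathSet z).nonempty⟩

end CPTRepresentation

theorem mainTheorem2 {X : Type*} [Finite X] [PartialOrder X]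
    (hconn : (comparabilityGraph X).Connected) (hP : IsDuallyCPT X)
    (R : CPTRepresentation X) :
    ∃ R' : CPTRepresentation X, R.Equivalent R' ∧
      ∀ M : Set X, IsNontrivialStrongModule M → ∀ x ∈ M, ¬ IsTrivialPath (R'.path x) := by
  -- Minimality is for inclusion of the sets of elements with trivial paths, subsets of the finite
  -- `X`.
  obtain ⟨R', hR'⟩ := exists_minimalFor_of_wellFoundedLT (fun _ : CPTRepresentation X => True)
    (fun R' => {z | IsTrivialPath (R'.path z)}) ⟨R, trivial⟩
  refine ⟨R', R.equivalent R', fun M hM x hx htriv => ?_⟩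
  obtain ⟨R'', hne, hle⟩ := R'.exists_not_isTrivialPath hconn hM hx htriv
  exact hne (hR'.2 trivial hle htriv)
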